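/- Let $n, q\ge 0$ be integers, let $U\subset\mathbb{C}^n$ be a non-empty open set, and let $u:U\to[-\infty,\infty)$ be upper semicontinuous. Then $u$ is $q$-plurisubharmonic on $U$ if and only if $u$ is $q$-plurisubharmonic on $U$ in the viscosity sense. Here the two notions are as follows. 1. ($q$-plurisubharmonic.) An upper semicontinuous function $v:V\to[-\infty,\infty)$ on an open subset $V$ of a finite-dimensional complex Euclidean space is *subpluriharmonic* on $V$ if either $v\equiv-\infty$ on $V$, or for every closed ball $\overline{B}\subset V$ of positive radius and every continuous plurisubharmonic function $h:W\to\mathbb{R}$ defined on an open neighbourhood $W$ of $\overline{B}$, the function $v+h$ attains its maximum over $\overline{B}$ at some point of the boundary sphere $bB$. If $q<n$, the function $u$ is *$q$-plurisubharmonic* on $U$ if for every $(q+1)$-dimensional complex affine subspace $\pi\subset\mathbb{C}^n$ the restriction of $u$ to $U\cap\pi$ is subpluriharmonic on $U\cap\pi$, viewed as an open subset of $\pi\cong\mathbb{C}^{q+1}$. If $q\ge n$, every upper semicontinuous function on $U$ is $q$-plurisubharmonic by convention. 2. ($q$-plurisubharmonic in the viscosity sense.) Either $u\equiv-\infty$ on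 $U$, or for every real-valued function $\varphi\in\mathcal{C}^2(U)$ and every point $\hat p\in U$ at which $u-\varphi$ attains its maximum over $U$, the complex Hessian $\left[\dfrac{\partial^2\varphi}{\partial z_k\,\partial\overline{z_\ell}}(\hat p)\right]_{k,\ell=1,\dots,n}$ has at most $q$ strictly negative eigenvalues, counted with multiplicity. -/

import Mathlib

/-- A continuous real-valued function `h` on an open subset `W` of a complex normed space is
plurisubharmonic on `W`: it satisfies the sub-mean value inequality on every closed complex disc
`{a + ζ b : |ζ| ≤ 1}` contained in `W`. (As `h` is continuous on `W`, the mean value over the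
boundary circle is a genuine integral.) -/
structure IsContPlurisubharmonicOn {E : Type*} [NormedAddCommGroup E] [NormedSpace ℂ E]
    (W : Set E) (h : E → ℝ) : Prop where
  continuousOn : ContinuousOn h W
  submean : ∀ a b : E, (∀ ζ : ℂ, ‖ζ‖ ≤ 1 → a + ζ • b ∈ W) →
    h a ≤ Real.circleAverage (fun ζ : ℂ => h (a + ζ • b)) 0 1

/-- Subpluriharmonicity on `U` of an upper semicontinuous `u : U → [-∞, ∞)`: either `u ≡ -∞`
on `U`, or for every compact ball `B ⊆ U` and every continuous plurisubharmonic function `h` on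
an open neighbourhood of `B`, the sum `u + h` attains its maximum over `B` at a boundary point. -/
def IsSubpluriharmonicOn {E : Type*} [NormedAddCommGroup E] [NormedSpace ℂ E]
    (U : Set E) (u : E → EReal) : Prop :=
  (∀ z ∈ U, u z = ⊥) ∨
    ∀ (a : E) (r : ℝ), 0 < r → Metric.closedBall a r ⊆ U →
      ∀ (W : Set E) (h : E → ℝ), IsOpen W → Metric.closedBall a r ⊆ W →
        IsContPlurisubharmonicOn W h →
          ∃ z₀ ∈ Metric.sphere a r,
            IsMaxOn (fun z => u z + (h z : EReal)) (Metric.closedBall a r) z₀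

/-- `q`-plurisubharmonicity on `U ⊆ ℂⁿ` of an upper semicontinuous `u : U → [-∞, ∞)`. For
`q < n`, the function `u` is subpluriharmonic on `U ∩ π` for every `(q+1)`-dimensional complex
affine subspace `π`; here `π` is identified isometrically with its direction by a base point
`p ∈ π`. For `q ≥ n` there is no condition. -/
def IsQPlurisubharmonicOn {n : ℕ} (q : ℕ) (U : Set (EuclideanSpace ℂ (Fin n)))
    (u : EuclideanSpace ℂ (Fin n) → EReal) : Prop :=
  q < n → ∀ π : AffineSubspace ℂ (EuclideanSpace ℂ (Fin n)),
    Module.finrank ℂ π.direction = q + 1 → ∀ p ∈ π,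
      IsSubpluriharmonicOn {v : π.direction | (v : EuclideanSpace ℂ (Fin n)) + p ∈ U}
        (fun v : π.direction => u ((v : EuclideanSpace ℂ (Fin n)) + p))

/-- The Wirtinger derivative `∂f/∂zₖ = (∂f/∂xₖ - i ∂f/∂yₖ) / 2` at the point `p`. -/
noncomputable def wirtingerDz {n : ℕ} (k : Fin n) (f : EuclideanSpace ℂ (Fin n) → ℂ)
    (p : EuclideanSpace ℂ (Fin n)) : ℂ :=
  (fderiv ℝ f p (EuclideanSpace.single k 1)
    - Complex.I * fderiv ℝ f p (EuclideanSpace.single k Complex.I)) / 2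

/-- The Wirtinger derivative `∂f/∂z̄ₖ = (∂f/∂xₖ + i ∂f/∂yₖ) / 2` at the point `p`. -/
noncomputable def wirtingerDzbar {n : ℕ} (k : Fin n) (f : EuclideanSpace ℂ (Fin n) → ℂ)
    (p : EuclideanSpace ℂ (Fin n)) : ℂ :=
  (fderiv ℝ f p (EuclideanSpace.single k 1)
    + Complex.I * fderiv ℝ f p (EuclideanSpace.single k Complex.I)) / 2

/-- The complex Hessian `[∂²φ/∂zₖ∂z̄ₗ]` of a real-valued function `φ` at the point `p`. -/
noncomputable def complexHessian {n : ℕ} (φ : EuclideanSpace ℂ (Fin n) → ℝ)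
    (p : EuclideanSpace ℂ (Fin n)) : Matrix (Fin n) (Fin n) ℂ :=
  Matrix.of fun k l => wirtingerDz k (wirtingerDzbar l (fun z => (φ z : ℂ))) p

open Classical in
/-- The number of strictly negative real eigenvalues of a complex square matrix, counted with
multiplicity as roots of the characteristic polynomial. -/
noncomputable def numNegEigenvalues {n : ℕ} (A : Matrix (Fin n) (Fin n) ℂ) : ℕ :=
  A.charpoly.roots.countP (fun μ : ℂ => μ.im = 0 ∧ μ.re < 0)

open Classical in
/-- For a Hermitian matrix this is the number of negative entries of its list of eigenvalues. -/
theorem numNegEigenvalues_eq_card {n : ℕ} {A : Matrix (Fin n) (Fin n) ℂ} (hA : A.IsHermitian) :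
    numNegEigenvalues A = (Finset.univ.filter fun i => hA.eigenvalues i < 0).card := by
  unfold numNegEigenvalues
  rw [hA.roots_charpoly_eq_eigenvalues, Multiset.countP_map, Finset.card_def]
  simp

/-- `q`-plurisubharmonicity in the viscosity sense on `U ⊆ ℂⁿ` of an upper semicontinuous
`u : U → [-∞, ∞)`. If `u` is not identically `-∞` on `U`, then `u p` is automatically finite at
every point `p` where `u - φ` attains its maximum over `U`. -/
def IsViscosityQPlurisubharmonicOn {n : ℕ} (q : ℕ) (U : Set (EuclideanSpace ℂ (Fin n)))
    (u : EuclideanSpace ℂ (Fin n) → EReal) : Prop :=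
  (∀ z ∈ U, u z = ⊥) ∨
    ∀ φ : EuclideanSpace ℂ (Fin n) → ℝ, ContDiffOn ℝ 2 φ U →
      ∀ p ∈ U, IsMaxOn (fun z => u z - (φ z : EReal)) U p →
        numNegEigenvalues (complexHessian φ p) ≤ q

/-! Both directions rest on one principle: a Hermitian form has at least `m` negative eigenvalues
exactly when it is negative definite on some `m`-dimensional subspace. The Hermitian form is the
Levi form of the test function, read off from averages over small circles.

If `u - φ` is maximal at `p` but the Hessian there has more than `q` negative eigenvalues, choose
`V` of dimension `q + 1` with Levi form at most `-c‖b‖²` on `V`. Minus the second-order Taylor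
polynomial of `φ` (without its constant), minus `c‖v‖²`, is plurisubharmonic on `V`. Added to `u` on
`p + V`, it gives values on a small sphere strictly below the value at `p`, so `u` is not
subpluriharmonic there.

Conversely, suppose `u + h` is larger inside a ball of `p + V` than on its sphere. Convolution
replaces `h` by a `C²` function `g`, and adding a small `ε‖v - a‖²` keeps the gap and makes the Levi
form at least `ε`. Subtracting `k` times the squared distance to `p + V` yields, for large `k`, an
interior maximum over a thin tube. The resulting test function has Levi form at most `-ε` on `V`. A
partition of unity makes the maximum global over `U`, contradicting the viscosity condition. The
carrying lemmas are `IsContPlurisubharmonicOn.exists_contDiff_approx`, `exists_penalized_isLocalMax`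
and `exists_contDiffOn_ge`. -/

section CircleAverage

/-! ### Circle averages of quadratic polynomials. -/

theorem circleIntegrable_comp_line {E : Type*} [NormedAddCommGroup E] [NormedSpace ℂ E] {h : E → ℝ} {a b : E}
    (hh : ∀ ζ : ℂ, ‖ζ‖ = 1 → ContinuousAt h (a + ζ • b)) :
    CircleIntegrable (fun ζ : ℂ => h (a + ζ • b)) 0 1 := by
  apply Continuous.intervalIntegrable
  rw [continuous_iff_continuousAt]
  intro θ
  have h1 : ContinuousAt h (a + circleMap 0 1 θ • b) := hh _ (by simp)
  exact ContinuousAt.comp (f := fun θ : ℝ => a + circleMap 0 1 θ • b) h1 (by fun_prop)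

variable {E : Type*} [NormedAddCommGroup E] [NormedSpace ℝ E] [NormedSpace ℂ E]
  [IsScalarTower ℝ ℂ E]

theorem circleMap_zero_one_smul (θ : ℝ) (b : E) :
    circleMap 0 1 θ • b = Real.cos θ • b + Real.sin θ • (Complex.I • b) := by
  have h : circleMap 0 1 θ = (Real.cos θ : ℂ) + (Real.sin θ : ℂ) * Complex.I := by
    simp [circleMap, Complex.exp_mul_I]
  rw [h, add_smul, mul_smul]
  congr 1
  · exact algebraMap_smul ℂ (Real.cos θ) b
  · exact algebraMap_smul ℂ (Real.sin θ) (Complex.I • b)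

/-- The mean over the unit circle of a real quadratic polynomial on a complex line. -/
theorem circleAverage_quadratic (c : ℝ) (l : E →L[ℝ] ℝ) (B : E →L[ℝ] E →L[ℝ] ℝ) (b : E) :
    Real.circleAverage (fun ζ : ℂ => c + l (ζ • b) + B (ζ • b) (ζ • b)) 0 1
      = c + (B b b + B (Complex.I • b) (Complex.I • b)) / 2 := by
  set b' := Complex.I • b with hb'
  have h : ∀ θ : ℝ, c + l (circleMap 0 1 θ • b) + B (circleMap 0 1 θ • b) (circleMap 0 1 θ • b)
      = c + l b * Real.cos θ + l b' * Real.sin θ + B b b * Real.cos θ ^ 2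
        + (B b b' + B b' b) * (Real.sin θ * Real.cos θ) + B b' b' * Real.sin θ ^ 2 := by
    intro θ
    rw [circleMap_zero_one_smul, ← hb']
    simp only [map_add, map_smul, add_apply, smul_apply,
      smul_eq_mul]
    ring
  rw [Real.circleAverage_def]
  simp only [h]
  have i0 (f : ℝ → ℝ) (hf : Continuous f) : IntervalIntegrable f MeasureTheory.volume 0
      (2 * Real.pi) := hf.intervalIntegrable _ _
  rw [intervalIntegral.integral_add (i0 _ (by fun_prop)) (i0 _ (by fun_prop)),
    intervalIntegral.integral_add (i0 _ (by fun_prop)) (i0 _ (by fun_prop)),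
    intervalIntegral.integral_add (i0 _ (by fun_prop)) (i0 _ (by fun_prop)),
    intervalIntegral.integral_add (i0 _ (by fun_prop)) (i0 _ (by fun_prop)),
    intervalIntegral.integral_add (i0 _ (by fun_prop)) (i0 _ (by fun_prop))]
  simp only [intervalIntegral.integral_const_mul, integral_cos, integral_sin,
    intervalIntegral.integral_const, integral_cos_sq, integral_sin_sq, integral_sin_mul_cos₁]
  simp
  field_simp
  ring

end CircleAverage

/-! ### Negative eigenvalues and negative definite subspaces. -/

section Hermitian

open Matrix

theorem Matrix.IsHermitian.re_dotProduct_mulVec_eq_sum {n : ℕ} {A : Matrix (Fin n) (Fin n) ℂ}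
    (hA : A.IsHermitian) (b : EuclideanSpace ℂ (Fin n)) :
    (star (b : Fin n → ℂ) ⬝ᵥ (A *ᵥ b)).re
      = ∑ i, hA.eigenvalues i * ‖hA.eigenvectorBasis.repr b i‖ ^ 2 := by
  set e := hA.eigenvectorBasis
  have h1 : star (b : Fin n → ℂ) ⬝ᵥ (A *ᵥ b) = inner ℂ b (WithLp.toLp 2 (A *ᵥ b)) := by
    rw [EuclideanSpace.inner_eq_star_dotProduct, dotProduct_comm]
  have h2 : WithLp.toLp 2 (A *ᵥ b) = ∑ i, (hA.eigenvalues i : ℂ) • e.repr b i • e i := by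
    have := congrArg (fun v : EuclideanSpace ℂ (Fin n) => A.toEuclideanLin v) (e.sum_repr b)
    simp only [map_sum, map_smul] at this
    rw [show WithLp.toLp 2 (A *ᵥ b) = A.toEuclideanLin b from rfl, ← this]
    refine Finset.sum_congr rfl fun i _ => ?_
    have : A.toEuclideanLin (e i) = (hA.eigenvalues i : ℂ) • e i := by
      ext j
      have := congrFun (hA.mulVec_eigenvectorBasis i) j
      simpa using this
    rw [this, smul_comm]
  rw [h1, h2, inner_sum, Complex.re_sum]
  refine Finset.sum_congr rfl fun i _ => ?_
  rw [inner_smul_right, inner_smul_right, e.repr_apply_apply, ← inner_conj_symm b (e i),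
    Complex.mul_conj, ← Complex.ofReal_mul, Complex.ofReal_re, Complex.normSq_eq_norm_sq]

theorem exists_submodule_of_le_numNegEigenvalues {n m : ℕ} {A : Matrix (Fin n) (Fin n) ℂ}
    (hA : A.IsHermitian) (hm : m ≤ numNegEigenvalues A) :
    ∃ V : Submodule ℂ (EuclideanSpace ℂ (Fin n)), Module.finrank ℂ V = m ∧
      ∃ c > 0, ∀ b ∈ V, (star (b : Fin n → ℂ) ⬝ᵥ (A *ᵥ b)).re ≤ -c * ‖b‖ ^ 2 := by
  classical
  rw [numNegEigenvalues_eq_card hA] at hm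
  obtain ⟨s, hs, hsc⟩ := Finset.exists_subset_card_eq hm
  set e := hA.eigenvectorBasis
  have hneg : ∀ i ∈ s, hA.eigenvalues i < 0 := fun i hi => by simpa using hs hi
  obtain ⟨c, hc, hcs⟩ : ∃ c > 0, ∀ i ∈ s, hA.eigenvalues i ≤ -c := by
    rcases s.eq_empty_or_nonempty with rfl | hne
    · exact ⟨1, one_pos, by simp⟩
    · obtain ⟨j, hj, hmax⟩ := s.exists_max_image hA.eigenvalues hne
      exact ⟨-hA.eigenvalues j, neg_pos.2 (hneg j hj), fun i hi => by simpa using hmax i hi⟩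
  refine ⟨Submodule.span ℂ (Set.range fun i : s => e i), ?_, c, hc, fun b hb => ?_⟩
  · have hli : LinearIndependent ℂ fun i : s => e i :=
      e.orthonormal.linearIndependent.comp _ Subtype.val_injective
    rw [finrank_span_eq_card hli, Fintype.card_coe, hsc]
  · have h0 : ∀ j ∉ s, e.repr b j = 0 := by
      intro j hj
      induction hb using Submodule.span_induction with
      | mem x hx =>
        obtain ⟨i, rfl⟩ := hx
        simp only [e.repr_self]
        rw [PiLp.single_apply, if_neg]
        rintro rfl
        exact hj i.2
      | zero => simp
      | add x y _ _ hx hy => simp [hx, hy]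
      | smul a x _ hx => simp [hx]
    rw [hA.re_dotProduct_mulVec_eq_sum, ← e.repr.norm_map b, EuclideanSpace.norm_sq_eq,
      Finset.mul_sum]
    refine Finset.sum_le_sum fun i _ => ?_
    by_cases hi : i ∈ s
    · exact mul_le_mul_of_nonneg_right (hcs i hi) (sq_nonneg _)
    · change _ * ‖e.repr b i‖ ^ 2 ≤ _
      rw [h0 i hi]; simp

/-- If `V` had larger dimension than the number of negative eigenvalues, some nonzero vector of `V`
would have no component along the negative eigenvectors, and the form would be nonnegative on it. -/
theorem le_numNegEigenvalues_of_submodule {n : ℕ} {A : Matrix (Fin n) (Fin n) ℂ}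
    (hA : A.IsHermitian) (V : Submodule ℂ (EuclideanSpace ℂ (Fin n)))
    (hV : ∀ b ∈ V, b ≠ 0 → (star (b : Fin n → ℂ) ⬝ᵥ (A *ᵥ b)).re < 0) :
    Module.finrank ℂ V ≤ numNegEigenvalues A := by
  classical
  rw [numNegEigenvalues_eq_card hA]
  by_contra! hlt
  set s := Finset.univ.filter fun i => hA.eigenvalues i < 0 with hs
  set e := hA.eigenvectorBasis
  let f : V →ₗ[ℂ] (s → ℂ) := LinearMap.pi fun i =>
    (e.toBasis.coord i).comp V.subtype
  have hf : LinearMap.ker f ≠ ⊥ := by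
    apply LinearMap.ker_ne_bot_of_finrank_lt
    simpa using hlt
  obtain ⟨b, hb, hb0⟩ := (Submodule.ne_bot_iff _).1 hf
  have hb' : ∀ i ∈ s, e.repr b i = 0 := by
    intro i hi
    have := congrFun (LinearMap.mem_ker.1 hb) ⟨i, hi⟩
    simpa [f] using this
  have := hV b b.2 (by simpa using hb0)
  rw [hA.re_dotProduct_mulVec_eq_sum] at this
  refine absurd this (not_lt.2 (Finset.sum_nonneg fun i _ => ?_))
  by_cases hi : i ∈ s
  · change 0 ≤ _ * ‖e.repr b i‖ ^ 2
    rw [hb' i hi]; simp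
  · have : 0 ≤ hA.eigenvalues i := by simpa [hs] using hi
    positivity

theorem numNegEigenvalues_transpose {n : ℕ} (A : Matrix (Fin n) (Fin n) ℂ) :
    numNegEigenvalues Aᵀ = numNegEigenvalues A := by
  unfold numNegEigenvalues
  rw [Matrix.charpoly_transpose]

theorem numNegEigenvalues_le {n : ℕ} (A : Matrix (Fin n) (Fin n) ℂ) :
    numNegEigenvalues A ≤ n := by
  classical
  unfold numNegEigenvalues
  refine (Multiset.countP_le_card _ _).trans ((Polynomial.card_roots' _).trans ?_)
  simp [Matrix.charpoly_natDegree_eq_dim]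

end Hermitian

/-! ### Taylor expansion and the Levi form from circle averages. -/

section Taylor

open Topology Filter

variable {E : Type*} [NormedAddCommGroup E] [NormedSpace ℝ E]

/-- The remainder has derivative `φ'(p + w) - φ'(p) - B w`, which is at most `ε‖w‖` near `0` because
`φ'` is differentiable at `p`. The mean value inequality on the ball of radius `‖v‖` concludes. -/
theorem ContDiffAt.second_order_taylor {φ : E → ℝ} {p : E} (hφ : ContDiffAt ℝ 2 φ p)
    {ε : ℝ} (hε : 0 < ε) :
    ∃ r > 0, ∀ v : E, ‖v‖ ≤ r →
      |φ (p + v) - (φ p + fderiv ℝ φ p v + 2⁻¹ * fderiv ℝ (fderiv ℝ φ) p v v)|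
        ≤ ε * ‖v‖ ^ 2 := by
  set B := fderiv ℝ (fderiv ℝ φ) p with hB
  have hsymm : ∀ v w, B v w = B w v :=
    hφ.isSymmSndFDerivAt (by simp)
  have hd : ∀ᶠ v in 𝓝 (0 : E), DifferentiableAt ℝ φ (p + v) := by
    have h1 : ∀ᶠ z in 𝓝 p, DifferentiableAt ℝ φ z :=
      (hφ.eventually (by simp)).mono fun z hz => hz.differentiableAt (by simp)
    have : Tendsto (fun v => p + v) (𝓝 0) (𝓝 p) :=
      Continuous.tendsto' (by fun_prop) _ _ (by simp)
    exact this.eventually h1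
  have hB2 : HasFDerivAt (fderiv ℝ φ) B p :=
    ((hφ.fderiv_right (m := 1) (by norm_num)).differentiableAt (by simp)).hasFDerivAt
  have hlo := (hasFDerivAt_iff_isLittleO_nhds_zero.1 hB2).def hε
  obtain ⟨r, hr, hball⟩ := Metric.eventually_nhds_iff_ball.1 (hd.and hlo)
  refine ⟨r / 2, half_pos hr, fun v hv => ?_⟩
  have hsub : Metric.closedBall (0 : E) ‖v‖ ⊆ Metric.ball 0 r :=
    Metric.closedBall_subset_ball (by linarith)
  let g : E → ℝ := fun w => φ (p + w) - (φ p + fderiv ℝ φ p w + 2⁻¹ * B w w)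
  have hg : ∀ w ∈ Metric.closedBall (0 : E) ‖v‖,
      HasFDerivWithinAt g (fderiv ℝ φ (p + w) - (fderiv ℝ φ p + B w))
        (Metric.closedBall 0 ‖v‖) w := by
    intro w hw
    have h1 : HasFDerivAt (fun w => φ (p + w)) (fderiv ℝ φ (p + w)) w := by
      have := (hball w (hsub hw)).1.hasFDerivAt
      exact this.comp w ((hasFDerivAt_id w).const_add p)
    have h2 : HasFDerivAt (fun w => B w w) ((2 : ℝ) • B w) w := by
      have := (B.hasFDerivAt (x := w)).clm_apply (hasFDerivAt_id w)
      convert! this using 1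
      ext y
      simp [hsymm y w, two_mul]
    have h3 := h1.sub (((fderiv ℝ φ p).hasFDerivAt.const_add (φ p)).add (h2.const_mul 2⁻¹))
    refine HasFDerivAt.hasFDerivWithinAt ?_
    convert! h3 using 1
    ext y
    simp
  have hbd : ∀ w ∈ Metric.closedBall (0 : E) ‖v‖,
      ‖fderiv ℝ φ (p + w) - (fderiv ℝ φ p + B w)‖ ≤ ε * ‖v‖ := by
    intro w hw
    have := (hball w (hsub hw)).2
    rw [sub_sub] at this
    refine this.trans (mul_le_mul_of_nonneg_left (by simpa using hw) hε.le)
  have := (convex_closedBall (0 : E) ‖v‖).norm_image_sub_le_of_norm_hasFDerivWithin_le hg hbd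
    (Metric.mem_closedBall_self (norm_nonneg v)) (y := v) (by simp)
  have hg0 : g 0 = 0 := by simp [g]
  rw [hg0, sub_zero, sub_zero, Real.norm_eq_abs] at this
  calc _ ≤ _ := this
    _ = ε * ‖v‖ ^ 2 := by ring

variable [NormedSpace ℂ E] [IsScalarTower ℝ ℂ E]

omit [IsScalarTower ℝ ℂ E] in
theorem eventually_norm_smul_smul_lt (b : E) {s : ℝ} (hs : 0 < s) :
    ∀ᶠ t in 𝓝[>] (0 : ℝ), ∀ ζ : ℂ, ‖ζ‖ = 1 → ‖ζ • t • b‖ < s := by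
  have : Tendsto (fun t : ℝ => ‖t • b‖) (𝓝[>] 0) (𝓝 0) :=
    (Continuous.tendsto' (by fun_prop) _ _ (by simp)).mono_left nhdsWithin_le_nhds
  filter_upwards [this.eventually (gt_mem_nhds hs)] with t ht ζ hζ
  rwa [norm_smul, hζ, one_mul]

/-- Upper bounds for small circle averages bound the Levi form. -/
theorem levi_le_of_circleAverage_le {φ : E → ℝ} {p b : E} {c : ℝ} (hφ : ContDiffAt ℝ 2 φ p)
    (h : ∀ᶠ t in 𝓝[>] (0 : ℝ),
      Real.circleAverage (fun ζ : ℂ => φ (p + ζ • t • b)) 0 1 ≤ φ p - c * t ^ 2) :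
    (fderiv ℝ (fderiv ℝ φ) p b b
      + fderiv ℝ (fderiv ℝ φ) p (Complex.I • b) (Complex.I • b)) / 4 ≤ -c := by
  set B := fderiv ℝ (fderiv ℝ φ) p with hB
  refine le_of_forall_pos_le_add fun δ hδ => ?_
  set ε := δ / (‖b‖ ^ 2 + 1) with hε_def
  have hε : 0 < ε := by positivity
  have hεb : ε * ‖b‖ ^ 2 ≤ δ := by
    rw [hε_def, div_mul_eq_mul_div, div_le_iff₀ (by positivity)]
    nlinarith
  obtain ⟨r, hr, hT⟩ := hφ.second_order_taylor hε
  have hcont : ∀ᶠ v in 𝓝 (0 : E), ContinuousAt φ (p + v) := by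
    have h1 : ∀ᶠ z in 𝓝 p, ContinuousAt φ z :=
      (hφ.eventually (by simp)).mono fun z hz => hz.continuousAt
    have : Tendsto (fun v => p + v) (𝓝 0) (𝓝 p) :=
      Continuous.tendsto' (by fun_prop) _ _ (by simp)
    exact this.eventually h1
  obtain ⟨r', hr', hball⟩ := Metric.eventually_nhds_iff_ball.1 hcont
  obtain ⟨t, ⟨ht, hts⟩, ht0⟩ := ((h.and (eventually_norm_smul_smul_lt b (lt_min hr hr'))).and
    self_mem_nhdsWithin).exists
  have ht0 : 0 < t := ht0
  have hnorm : ∀ ζ : ℂ, ‖ζ‖ = 1 → ‖ζ • t • b‖ = t * ‖b‖ := by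
    intro ζ hζ
    rw [norm_smul, norm_smul, hζ, one_mul, Real.norm_of_nonneg ht0.le]
  -- The left side is the exact circle average of the Taylor polynomial lowered by its error bound;
  -- dividing by `t²` leaves the claim up to `δ`.
  have key : φ p - ε * (t * ‖b‖) ^ 2
        + ((2⁻¹ : ℝ) • B) (t • b) (t • b) / 2
        + ((2⁻¹ : ℝ) • B) (Complex.I • t • b) (Complex.I • t • b) / 2
      ≤ φ p - c * t ^ 2 := by
    refine le_trans (le_of_eq ?_) ((Real.circleAverage_mono (f₁ := fun ζ : ℂ =>
      (φ p - ε * (t * ‖b‖) ^ 2) + fderiv ℝ φ p (ζ • t • b)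
        + ((2⁻¹ : ℝ) • B) (ζ • t • b) (ζ • t • b)) ?_ ?_ ?_).trans ht)
    · rw [circleAverage_quadratic]; ring
    · refine Continuous.intervalIntegrable ?_ _ _
      fun_prop
    · refine circleIntegrable_comp_line fun ζ hζ => hball _ ?_
      rw [mem_ball_zero_iff]
      exact (hts ζ hζ).trans_le (min_le_right _ _)
    · intro ζ hζ
      have hζ : ‖ζ‖ = 1 := by simpa using hζ
      have h1 := hT (ζ • t • b) ((hts ζ hζ).le.trans (min_le_left _ _))
      rw [hnorm ζ hζ] at h1
      have h2 := (abs_le.1 h1).1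
      simp only [smul_apply, smul_eq_mul]
      linarith
  have hcomm : Complex.I • t • b = t • Complex.I • b := smul_comm _ _ _
  rw [hcomm] at key
  simp only [smul_apply, map_smul, smul_eq_mul] at key
  have ht2 : 0 < t ^ 2 := by positivity
  have : t ^ 2 * ((B b b + B (Complex.I • b) (Complex.I • b)) / 4) ≤ t ^ 2 * (-c + δ) := by
    nlinarith
  exact le_of_mul_le_mul_left this ht2

end Taylor

/-! ### The complex Hessian as the matrix of the Levi form. -/

section Hessian

open Matrix

variable {n : ℕ}

/-- The sesquilinear form attached to a real bilinear form, linear in the first variable. -/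
noncomputable def leviSesq {E : Type*} [NormedAddCommGroup E] [NormedSpace ℝ E] [NormedSpace ℂ E]
    [IsScalarTower ℝ ℂ E] (B : E →L[ℝ] E →L[ℝ] ℝ) :
    E →ₗ[ℂ] E →ₗ⋆[ℂ] ℂ :=
  LinearMap.mk₂'ₛₗ (RingHom.id ℂ) (starRingEnd ℂ)
    (fun x y => (⟨B x y + B (Complex.I • x) (Complex.I • y),
      B x (Complex.I • y) - B (Complex.I • x) y⟩ : ℂ) / 4)
    (by
      intro x x' y
      rw [← add_div]
      congr 1
      apply Complex.ext <;> simp <;> ring)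
    (by
      intro c x y
      have hc (z : E) : c • z = c.re • z + c.im • Complex.I • z := by
        conv_lhs => rw [← Complex.re_add_im c, add_smul, mul_smul]
        congr 1
        · exact algebraMap_smul ℂ c.re z
        · exact algebraMap_smul ℂ c.im (Complex.I • z)
      have hI : Complex.I • Complex.I • x = -x := by rw [smul_smul]; simp
      rw [smul_comm Complex.I c x, RingHom.id_apply, smul_eq_mul, ← mul_div_assoc]
      congr 1
      rw [hc x, hc (Complex.I • x), hI]
      apply Complex.ext <;> simp <;> ring)
    (by
      intro x y y'
      rw [← add_div]
      congr 1
      apply Complex.ext <;> simp <;> ring)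
    (by
      intro c x y
      have hc (z : E) : c • z = c.re • z + c.im • Complex.I • z := by
        conv_lhs => rw [← Complex.re_add_im c, add_smul, mul_smul]
        congr 1
        · exact algebraMap_smul ℂ c.re z
        · exact algebraMap_smul ℂ c.im (Complex.I • z)
      have hI : Complex.I • Complex.I • y = -y := by rw [smul_smul]; simp
      rw [smul_comm Complex.I c y, smul_eq_mul, ← mul_div_assoc]
      congr 1
      rw [hc y, hc (Complex.I • y), hI]
      apply Complex.ext <;> simp <;> ring)

theorem leviSesq_apply {E : Type*} [NormedAddCommGroup E] [NormedSpace ℝ E] [NormedSpace ℂ E]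
    [IsScalarTower ℝ ℂ E] (B : E →L[ℝ] E →L[ℝ] ℝ) (x y : E) :
    leviSesq B x y = (⟨B x y + B (Complex.I • x) (Complex.I • y),
      B x (Complex.I • y) - B (Complex.I • x) y⟩ : ℂ) / 4 := rfl

theorem complexHessian_apply_eq_leviSesq {φ : EuclideanSpace ℂ (Fin n) → ℝ}
    {p : EuclideanSpace ℂ (Fin n)} (hφ : ContDiffAt ℝ 2 φ p) (k l : Fin n) :
    complexHessian φ p k l = leviSesq (fderiv ℝ (fderiv ℝ φ) p)
      (EuclideanSpace.single k 1) (EuclideanSpace.single l 1) := by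
  set B := fderiv ℝ (fderiv ℝ φ) p with hB
  have hs (k : Fin n) : EuclideanSpace.single k Complex.I
      = Complex.I • (EuclideanSpace.single k 1 : EuclideanSpace ℂ (Fin n)) := by
    ext j; simp [PiLp.single_apply]
  have hB2 : HasFDerivAt (fderiv ℝ φ) B p :=
    ((hφ.fderiv_right (m := 1) (by norm_num)).differentiableAt (by simp)).hasFDerivAt
  have hev : wirtingerDzbar l (fun z => (φ z : ℂ)) =ᶠ[nhds p] fun z =>
      (Complex.ofRealCLM (fderiv ℝ φ z (EuclideanSpace.single l 1))
        + Complex.I * Complex.ofRealCLM (fderiv ℝ φ z (EuclideanSpace.single l Complex.I)))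
        / 2 := by
    filter_upwards [hφ.eventually (by simp)] with z hz
    have h1 : HasFDerivAt (fun z => (φ z : ℂ)) (Complex.ofRealCLM.comp (fderiv ℝ φ z)) z :=
      Complex.ofRealCLM.hasFDerivAt.comp z (hz.differentiableAt (by simp)).hasFDerivAt
    simp [wirtingerDzbar, h1.fderiv]
  have hap (w : EuclideanSpace ℂ (Fin n)) :
      HasFDerivAt (fun z => Complex.ofRealCLM (fderiv ℝ φ z w))
        (Complex.ofRealCLM.comp (B.flip w)) p :=
    Complex.ofRealCLM.hasFDerivAt.comp p
      (by simpa using hB2.clm_apply (hasFDerivAt_const w p))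
  have hD : HasFDerivAt (wirtingerDzbar l (fun z => (φ z : ℂ)))
      ((2⁻¹ : ℂ) • (Complex.ofRealCLM.comp (B.flip (EuclideanSpace.single l 1))
        + Complex.I • Complex.ofRealCLM.comp (B.flip (EuclideanSpace.single l Complex.I)))) p := by
    refine HasFDerivAt.congr_of_eventuallyEq ?_ hev
    have := ((hap (EuclideanSpace.single l 1)).add
      ((hap (EuclideanSpace.single l Complex.I)).const_mul Complex.I)).const_mul (2⁻¹ : ℂ)
    convert! this using 1
    ext z
    simp [div_eq_inv_mul]
  rw [complexHessian, Matrix.of_apply, wirtingerDz, hD.fderiv, leviSesq_apply]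
  simp only [hs]
  simp only [_root_.smul_apply, _root_.add_apply, ContinuousLinearMap.comp_apply, ContinuousLinearMap.flip_apply,
    smul_eq_mul, Complex.ofRealCLM_apply]
  apply Complex.ext <;> simp <;> ring

theorem complexHessian_isHermitian {φ : EuclideanSpace ℂ (Fin n) → ℝ}
    {p : EuclideanSpace ℂ (Fin n)} (hφ : ContDiffAt ℝ 2 φ p) :
    (complexHessian φ p).IsHermitian := by
  have hsymm : ∀ v w, fderiv ℝ (fderiv ℝ φ) p v w = fderiv ℝ (fderiv ℝ φ) p w v :=
    hφ.isSymmSndFDerivAt (by simp)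
  ext k l
  rw [conjTranspose_apply, complexHessian_apply_eq_leviSesq hφ,
    complexHessian_apply_eq_leviSesq hφ, leviSesq_apply, leviSesq_apply]
  set e : EuclideanSpace ℂ (Fin n) := EuclideanSpace.single k 1
  set f : EuclideanSpace ℂ (Fin n) := EuclideanSpace.single l 1
  rw [hsymm f e, hsymm (Complex.I • f) (Complex.I • e), hsymm f (Complex.I • e),
    hsymm (Complex.I • f) e]
  apply Complex.ext <;> simp

/-- The Levi form is `∑ H k l * b k * conj (b l)`, with the conjugate on the column index, hence the
transpose. Transposing keeps the eigenvalue count. -/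
theorem re_dotProduct_transpose_complexHessian {φ : EuclideanSpace ℂ (Fin n) → ℝ}
    {p : EuclideanSpace ℂ (Fin n)} (hφ : ContDiffAt ℝ 2 φ p) (b : EuclideanSpace ℂ (Fin n)) :
    (star (b : Fin n → ℂ) ⬝ᵥ ((complexHessian φ p)ᵀ *ᵥ b)).re
      = (fderiv ℝ (fderiv ℝ φ) p b b
        + fderiv ℝ (fderiv ℝ φ) p (Complex.I • b) (Complex.I • b)) / 4 := by
  set B := fderiv ℝ (fderiv ℝ φ) p with hB
  have hb : b = ∑ k, b k • (EuclideanSpace.single k 1 : EuclideanSpace ℂ (Fin n)) := by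
    simpa using ((EuclideanSpace.basisFun (Fin n) ℂ).sum_repr b).symm
  have h1 : star (b : Fin n → ℂ) ⬝ᵥ ((complexHessian φ p)ᵀ *ᵥ b) = leviSesq B b b := by
    conv_rhs => rw [hb]
    simp only [map_sum, LinearMap.map_smulₛₗ, LinearMap.sum_apply, LinearMap.smul_apply,
      dotProduct, mulVec, transpose_apply, complexHessian_apply_eq_leviSesq hφ, Finset.mul_sum,
      smul_eq_mul, RingHom.id_apply, Pi.star_apply, RCLike.star_def, ← hB]
    refine Finset.sum_congr rfl fun l _ => ?_
    refine Finset.sum_congr rfl fun k _ => ?_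
    ring
  rw [h1, leviSesq_apply]
  simp

end Hessian

/-! ### From `q`-plurisubharmonic to viscosity. -/

/-- The restriction to `V` of a quadratic polynomial with nonnegative Levi form on `V` is
plurisubharmonic. -/
theorem isContPlurisubharmonicOn_quadratic {E : Type*} [NormedAddCommGroup E] [NormedSpace ℝ E]
    [NormedSpace ℂ E] [IsScalarTower ℝ ℂ E] (V : Submodule ℂ E) (l : E →L[ℝ] ℝ)
    (B : E →L[ℝ] E →L[ℝ] ℝ)
    (hB : ∀ b ∈ V, 0 ≤ B b b + B (Complex.I • b) (Complex.I • b)) :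
    IsContPlurisubharmonicOn (Set.univ : Set V) (fun v : V => l v + B v v) where
  continuousOn := by fun_prop
  submean a b _ := by
    have h1 : (fun ζ : ℂ => l ((a + ζ • b : V) : E) + B (a + ζ • b : V) (a + ζ • b : V))
        = fun ζ : ℂ => (l a + B a a) + (l + B a + B.flip a) (ζ • (b : E))
          + B (ζ • (b : E)) (ζ • (b : E)) := by
      ext ζ
      simp only [Submodule.coe_add, Submodule.coe_smul, map_add, add_apply,
        ContinuousLinearMap.flip_apply]
      ring
    rw [h1, circleAverage_quadratic]
    linarith [hB b b.2]

theorem IsQPlurisubharmonicOn.isViscosityQPlurisubharmonicOn {n q : ℕ}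
    {U : Set (EuclideanSpace ℂ (Fin n))} (hU : IsOpen U) {u : EuclideanSpace ℂ (Fin n) → EReal}
    (hu : ∀ z ∈ U, u z ≠ ⊤) (h : IsQPlurisubharmonicOn q U u) :
    IsViscosityQPlurisubharmonicOn q U u := by
  refine or_iff_not_imp_left.2 fun hbot φ hφ p hp hmax => ?_
  push Not at hbot
  obtain ⟨z₀, hz₀, hz₀b⟩ := hbot
  by_contra! hlt
  -- There are at most `n` eigenvalues, so the case `q ≥ n` is excluded here.
  have hqn : q < n := hlt.trans_le (numNegEigenvalues_le _)
  have hφp : ContDiffAt ℝ 2 φ p := hφ.contDiffAt (hU.mem_nhds hp)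
  rw [← numNegEigenvalues_transpose] at hlt
  obtain ⟨V, hV, c, hc, hVc⟩ := exists_submodule_of_le_numNegEigenvalues
    (complexHessian_isHermitian hφp).transpose (Nat.succ_le_of_lt hlt)
  simp only [re_dotProduct_transpose_complexHessian hφp] at hVc
  set B := fderiv ℝ (fderiv ℝ φ) p with hB
  have hup : u p ≠ ⊥ := by
    intro hup
    have : u z₀ - φ z₀ ≤ u p - φ p := hmax hz₀
    rw [hup, EReal.bot_sub, le_bot_iff, sub_eq_add_neg, EReal.add_eq_bot_iff] at this
    rcases this with h | h
    · exact hz₀b h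
    · simp at h
  -- Taylor error `c / 2` against the subtracted `c‖v‖²` leaves a strict margin `c r² / 2` on the
  -- sphere.
  obtain ⟨r₁, hr₁, hT⟩ := hφp.second_order_taylor (half_pos hc)
  obtain ⟨r₂, hr₂, hball⟩ := Metric.isOpen_iff.1 hU p hp
  set r := min r₁ (r₂ / 2) with hr_def
  have hr : 0 < r := lt_min hr₁ (half_pos hr₂)
  have hrU : ∀ v : EuclideanSpace ℂ (Fin n), ‖v‖ ≤ r → v + p ∈ U := by
    intro v hv
    refine hball ?_
    rw [Metric.mem_ball, dist_eq_norm, add_sub_cancel_right]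
    have := hv.trans (min_le_right _ _)
    linarith
  have hfin : Module.finrank ℂ (AffineSubspace.mk' p V).direction = q + 1 := by
    rw [AffineSubspace.direction_mk']; exact hV
  have hsub := h hqn (AffineSubspace.mk' p V) hfin p (AffineSubspace.self_mem_mk' _ _)
  rw [AffineSubspace.direction_mk'] at hsub
  rcases hsub with hb | hsub
  · exact hup (by simpa using hb 0 (by simpa using hp))
  let N : EuclideanSpace ℂ (Fin n) →L[ℝ] EuclideanSpace ℂ (Fin n) →L[ℝ] ℝ := innerSL ℝ
  have hN (v : EuclideanSpace ℂ (Fin n)) : N v v = ‖v‖ ^ 2 := real_inner_self_eq_norm_sq v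
  -- The coefficient `c` is the largest that the bound `hVc` allows: `B' b b + B' (I b) (I b) ≥
  -- 2c‖b‖² - 2c‖b‖² = 0` on `V`.
  set B' := -((2⁻¹ : ℝ) • B) - c • N
  have hB'app : ∀ v, B' v v = -(2⁻¹ * B v v) - c * ‖v‖ ^ 2 := by
    intro v
    simp [B', hN]
  obtain ⟨w, hw, hwmax⟩ := hsub 0 r hr
    (fun v hv => hrU v (by simpa using hv)) Set.univ
    (fun v => (-fderiv ℝ φ p) v + B' v v) isOpen_univ (Set.subset_univ _)
    (isContPlurisubharmonicOn_quadratic V _ _ (fun b hb => by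
      have := hVc b hb
      rw [hB'app, hB'app, norm_smul, Complex.norm_I, one_mul]
      linarith))
  have hw : ‖(w : EuclideanSpace ℂ (Fin n))‖ = r := by simpa using hw
  have h1 : u ((0 : V) + p)
      + (((-fderiv ℝ φ p) (0 : V) + B' (0 : V) (0 : V) : ℝ) : EReal) ≤
      u (w + p) + (((-fderiv ℝ φ p) w + B' w w : ℝ) : EReal) :=
    hwmax (Metric.mem_closedBall_self hr.le)
  have hwU : (w + p : EuclideanSpace ℂ (Fin n)) ∈ U := hrU w hw.le
  have h2 : u (w + p) - φ (w + p) ≤ u p - φ p := hmax hwU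
  have h3 := hT w (hw.le.trans (min_le_left _ _))
  rw [hw] at h3
  lift u p to ℝ using ⟨hu p hp, hup⟩ with x hx
  simp only [Submodule.coe_zero, zero_add, map_zero, add_zero, EReal.coe_zero, ← hx] at h1
  have hwt := hu _ hwU
  induction hy : u (w + p) with
  | bot => simp [hy] at h1
  | top => exact hwt hy
  | coe y =>
    rw [hy] at h1 h2
    norm_cast at h1 h2
    rw [hB'app, hw, neg_apply] at h1
    rw [add_comm p] at h3
    have := (abs_le.1 h3).2
    have : 0 < c * r ^ 2 := by positivity
    linarith

/-! ### Smoothing of continuous plurisubharmonic functions. -/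

section Smoothing

open MeasureTheory Metric Convolution

variable {E : Type*} [NormedAddCommGroup E] [NormedSpace ℝ E] [NormedSpace ℂ E]
  [FiniteDimensional ℝ E]

/-- A continuous function satisfying a sub-mean value inequality at the translates `x - t`, for
`t` in the support of a nonnegative kernel, satisfies it at `x` after convolution. -/
theorem le_circleAverage_integral_mul [MeasurableSpace E] [BorelSpace E] {μ : Measure E}
    [IsLocallyFiniteMeasure μ] [SFinite μ] {ρ G : E → ℝ} (hρ : Continuous ρ) (hG : Continuous G)
    (hρ0 : ∀ t, 0 ≤ ρ t) {R : ℝ} (hρR : Function.support ρ ⊆ closedBall 0 R) {x b : E}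
    (hsub : ∀ t ∈ closedBall (0 : E) R,
      G (x - t) ≤ Real.circleAverage (fun ζ : ℂ => G (x - t + ζ • b)) 0 1) :
    ∫ t, ρ t * G (x - t) ∂μ
      ≤ Real.circleAverage (fun ζ : ℂ => ∫ t, ρ t * G (x + ζ • b - t) ∂μ) 0 1 := by
  have : ProperSpace E := FiniteDimensional.proper ℝ E
  have hS : IsCompact (closedBall (0 : E) R) := isCompact_closedBall _ _
  -- On a compact ball containing the support of `ρ`, continuity alone gives the integrability
  -- needed for Fubini.
  have hrestr (f : E → ℝ) : ∫ t, ρ t * f t ∂μ = ∫ t in closedBall 0 R, ρ t * f t ∂μ := by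
    refine (setIntegral_eq_integral_of_forall_compl_eq_zero fun t ht => ?_).symm
    rw [Function.notMem_support.1 fun h => ht (hρR h), zero_mul]
  have hF : Continuous (Function.uncurry fun (θ : ℝ) (t : E) =>
      ρ t * G (x + circleMap 0 1 θ • b - t)) := by
    unfold Function.uncurry
    fun_prop
  have hint : Integrable (Function.uncurry fun (θ : ℝ) (t : E) =>
      ρ t * G (x + circleMap 0 1 θ • b - t))
      ((volume.restrict (Set.Ioc 0 (2 * Real.pi))).prod (μ.restrict (closedBall 0 R))) := by
    rw [Measure.prod_restrict]
    exact (hF.continuousOn.integrableOn_compact (isCompact_Icc.prod hS)).mono_set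
      (Set.prod_mono Set.Ioc_subset_Icc_self le_rfl)
  have hswap : Real.circleAverage (fun ζ : ℂ => ∫ t, ρ t * G (x + ζ • b - t) ∂μ) 0 1
      = ∫ t in closedBall 0 R,
        ρ t * Real.circleAverage (fun ζ : ℂ => G (x - t + ζ • b)) 0 1 ∂μ := by
    simp only [Real.circleAverage_def, hrestr]
    rw [intervalIntegral.integral_of_le Real.two_pi_pos.le, integral_integral_swap hint,
      smul_eq_mul, ← integral_const_mul]
    refine integral_congr_ae (Filter.Eventually.of_forall fun t => ?_)
    simp only [integral_const_mul, smul_eq_mul, intervalIntegral.integral_of_le Real.two_pi_pos.le,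
      add_sub_right_comm]
    ring
  rw [hswap, hrestr]
  refine setIntegral_mono_on ?_ ?_ measurableSet_closedBall fun t ht =>
    mul_le_mul_of_nonneg_left (hsub t ht) (hρ0 t)
  · have hc : Continuous fun t => ρ t * G (x - t) := by fun_prop
    exact hc.continuousOn.integrableOn_compact hS
  · suffices hc : Continuous fun t =>
        ρ t * Real.circleAverage (fun ζ : ℂ => G (x - t + ζ • b)) 0 1 from
      hc.continuousOn.integrableOn_compact hS
    refine hρ.mul ?_
    simp only [Real.circleAverage_def, smul_eq_mul]
    refine continuous_const.mul
      (intervalIntegral.continuous_parametric_intervalIntegral_of_continuous' ?_ _ _)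
    unfold Function.uncurry
    fun_prop

/-- Convolution with a narrow bump preserves the sub-mean value inequality. Only small circles are
controlled, which suffices for the Levi form. -/
theorem IsContPlurisubharmonicOn.exists_contDiff_approx {W : Set E} {h : E → ℝ}
    (hh : IsContPlurisubharmonicOn W h) (hW : IsOpen W) {a : E} {r : ℝ}
    (har : closedBall a r ⊆ W) {ε : ℝ} (hε : 0 < ε) :
    ∃ g : E → ℝ, ContDiff ℝ 2 g ∧ (∀ x ∈ closedBall a r, |g x - h x| ≤ ε) ∧
      ∃ η > 0, ∀ x ∈ closedBall a r, ∀ b : E, ‖b‖ ≤ η →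
        g x ≤ Real.circleAverage (fun ζ : ℂ => g (x + ζ • b)) 0 1 := by
  have : ProperSpace E := FiniteDimensional.proper ℝ E
  let _ : MeasurableSpace E := borel E
  have : BorelSpace E := ⟨rfl⟩
  let μ : Measure E := Measure.addHaar
  obtain ⟨η, hη, hηW⟩ := (isCompact_closedBall a r).exists_cthickening_subset_open hW har
  set K := cthickening η (closedBall a r)
  have hK : IsCompact K := (isCompact_closedBall a r).cthickening
  -- Tietze extension: `h` is controlled only on `W`, while convolution needs a globally continuous
  -- function.
  obtain ⟨G, hG⟩ := ContinuousMap.exists_restrict_eq (s := K) isClosed_cthickening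
    ⟨K.domRestrict h, (hh.continuousOn.mono hηW).domRestrict⟩
  have hGh : ∀ x ∈ K, G x = h x := fun x hx => by
    exact DFunLike.congr_fun hG ⟨x, hx⟩
  have hmemK : ∀ x ∈ closedBall a r, ∀ v : E, ‖v‖ ≤ η → x + v ∈ K := fun x hx v hv =>
    mem_cthickening_of_dist_le _ x _ _ hx (by simpa [dist_eq_norm] using hv)
  obtain ⟨δ, hδ, hGδ⟩ := Metric.uniformContinuousOn_iff.1
    (hK.uniformContinuousOn_of_continuous G.continuous.continuousOn) ε hε
  -- Translation by the support and motion along the disc each cost at most `η / 2`, so all points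
  -- stay in `K`, where `G = h`; `δ` controls the approximation error.
  have hR : 0 < min (η / 2) δ := lt_min (half_pos hη) hδ
  let ρ : ContDiffBump (0 : E) := ⟨min (η / 2) δ / 2, min (η / 2) δ, half_pos hR, half_lt_self hR⟩
  have hRout : ρ.rOut = min (η / 2) δ := rfl
  refine ⟨ρ.normed μ ⋆[ContinuousLinearMap.lsmul ℝ ℝ, μ] G, ?_, fun x hx => ?_,
    η / 2, half_pos hη, fun x hx b hb => ?_⟩
  · exact ρ.hasCompactSupport_normed.contDiff_convolution_left (n := 2) _ ρ.contDiff_normed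
      G.continuous.locallyIntegrable
  · have hxK : x ∈ K := by simpa using hmemK x hx 0 (by simpa using hη.le)
    rw [← hGh x hxK, ← Real.dist_eq]
    refine ρ.dist_normed_convolution_le G.continuous.aestronglyMeasurable fun y hy => ?_
    rw [hRout, mem_ball, lt_min_iff] at hy
    refine (hGδ y ?_ x hxK hy.2).le
    have := hmemK x hx (y - x) (by rw [← dist_eq_norm]; linarith)
    simpa using this
  · simp only [convolution_def, ContinuousLinearMap.lsmul_apply, smul_eq_mul]
    refine le_circleAverage_integral_mul (R := ρ.rOut) ρ.continuous_normed G.continuous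
      (fun t => ρ.nonneg_normed t) ?_ fun t ht => ?_
    · rw [ρ.support_normed_eq]
      exact ball_subset_closedBall
    · have ht : ‖t‖ ≤ η / 2 := by
        rw [mem_closedBall_zero_iff, hRout] at ht
        exact ht.trans (min_le_left _ _)
      have hmem : ∀ ζ : ℂ, ‖ζ‖ ≤ 1 → x - t + ζ • b ∈ K := by
        intro ζ hζ
        rw [sub_add_eq_add_sub, add_sub_assoc]
        refine hmemK x hx _ ((norm_sub_le _ _).trans ?_)
        have : ‖ζ • b‖ ≤ η / 2 := by
          rw [norm_smul]
          exact (mul_le_of_le_one_left (norm_nonneg b) hζ).trans hb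
        linarith
      have h0 : x - t ∈ K := by simpa using hmem 0 (by simp)
      rw [hGh _ h0, Real.circleAverage_congr_sphere (f₂ := fun ζ : ℂ => h (x - t + ζ • b))]
      · exact hh.submean _ _ fun ζ hζ => hηW (hmem ζ hζ)
      · intro ζ hζ
        exact hGh _ (hmem ζ (by simpa using hζ.le))

end Smoothing

/-! ### Domination by `C²` functions. -/

section Domination

open Topology Filter

theorem UpperSemicontinuousOn.add_coe {α : Type*} [TopologicalSpace α] {s : Set α} {u : α → EReal}
    {f : α → ℝ} (hu : UpperSemicontinuousOn u s) (hf : ContinuousOn f s) :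
    UpperSemicontinuousOn (fun z => u z + (f z : EReal)) s :=
  hu.add' (continuous_coe_real_ereal.comp_continuousOn hf).upperSemicontinuousOn
    fun x _ => EReal.continuousAt_add (by simp) (by simp)

/-- An upper semicontinuous function on an open set which is nonpositive near `p` is dominated by
a function of class `C²` vanishing near `p`. -/
theorem exists_contDiffOn_ge {E : Type*} [NormedAddCommGroup E] [NormedSpace ℝ E]
    [FiniteDimensional ℝ E] {U : Set E} (hU : IsOpen U) {w : E → EReal}
    (hw : UpperSemicontinuousOn w U) (hwt : ∀ z ∈ U, w z ≠ ⊤) {p : E}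
    (hwp : ∀ᶠ z in 𝓝 p, w z ≤ 0) :
    ∃ θ : E → ℝ, ContDiffOn ℝ 2 θ U ∧ θ =ᶠ[𝓝[U] p] 0 ∧ ∀ z ∈ U, w z ≤ θ z := by
  classical
  have : ProperSpace E := FiniteDimensional.proper ℝ E
  obtain ⟨s, hs, hball⟩ := Metric.eventually_nhds_iff_ball.1 hwp
  -- The function `w` may be unbounded towards the boundary of `U`, so the partition of unity lives
  -- on the manifold `U`.
  let M : TopologicalSpace.Opens E := ⟨U, hU⟩
  have : LocallyCompactSpace M := hU.locallyCompactSpace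
  -- The admissible values at `z` form a convex set, reduced to `0` near `p`. Locally a constant is
  -- admissible: `0` in the ball of radius `s`, an upper bound from semicontinuity elsewhere.
  let t : M → Set ℝ := fun z => {y | w z ≤ y ∧ ((z : E) ∈ Metric.closedBall p (s / 2) → y = 0)}
  have ht : ∀ z, Convex ℝ (t z) := fun z =>
    Set.OrdConnected.convex ⟨fun x hx y hy v hv =>
      ⟨hx.1.trans (EReal.coe_le_coe_iff.2 hv.1), fun h =>
        le_antisymm (hv.2.trans_eq (hy.2 h)) ((hx.2 h).ge.trans hv.1)⟩⟩
  have hloc : ∀ z : M, ∃ c : ℝ, ∀ᶠ y in 𝓝 z, c ∈ t y := by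
    intro z
    by_cases hz : (z : E) ∈ Metric.ball p s
    · refine ⟨0, ?_⟩
      have : ∀ᶠ y : M in 𝓝 z, (y : E) ∈ Metric.ball p s :=
        continuous_subtype_val.continuousAt.eventually (Metric.isOpen_ball.mem_nhds hz)
      filter_upwards [this] with y hy
      exact ⟨hball _ hy, fun _ => rfl⟩
    · obtain ⟨c, hc, -⟩ := EReal.lt_iff_exists_real_btwn.1 (lt_top_iff_ne_top.2 (hwt z z.2))
      refine ⟨c, ?_⟩
      have h1 : ∀ᶠ y : M in 𝓝 z, w y < c := by
        have := hw z z.2 c hc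
        rw [hU.nhdsWithin_eq z.2] at this
        exact continuous_subtype_val.continuousAt.eventually this
      have h2 : ∀ᶠ y : M in 𝓝 z, (y : E) ∉ Metric.closedBall p (s / 2) := by
        refine continuous_subtype_val.continuousAt.eventually
          (Metric.isClosed_closedBall.isOpen_compl.mem_nhds fun h => hz ?_)
        exact Metric.closedBall_subset_ball (half_lt_self hs) h
      filter_upwards [h1, h2] with y hy1 hy2
      exact ⟨hy1.le, fun h => absurd h hy2⟩
  obtain ⟨g, hg⟩ := exists_contMDiffMap_forall_mem_convex_of_local_const (n := 2)
    (modelWithCornersSelf ℝ E) ht hloc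
  let θ : E → ℝ := fun z => if h : z ∈ U then g ⟨z, h⟩ else 0
  have hθ : ∀ z (h : z ∈ U), θ z = g ⟨z, h⟩ := fun z h => dif_pos h
  have hθg : (fun z : M => θ z) = g := funext fun z => hθ z z.2
  refine ⟨θ, fun z hz => ?_, ?_, fun z hz => ?_⟩
  · have h1 : ContMDiffAt (modelWithCornersSelf ℝ E) (modelWithCornersSelf ℝ ℝ) 2
        (fun z : M => θ z) ⟨z, hz⟩ := by
      rw [hθg]; exact g.contMDiff.contMDiffAt
    exact (contMDiffAt_iff_contDiffAt.1 (contMDiffAt_subtype_iff.1 h1)).contDiffWithinAt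
  · filter_upwards [self_mem_nhdsWithin,
      nhdsWithin_le_nhds (Metric.closedBall_mem_nhds p (half_pos hs))] with z hz hzs
    rw [hθ z hz]
    exact (hg ⟨z, hz⟩).2 hzs
  · rw [hθ z hz]
    exact (hg ⟨z, hz⟩).1

end Domination

/-! ### Localising the viscosity condition. -/

section Viscosity

open Topology Filter Metric

variable {n : ℕ}

theorem finrank_le_numNegEigenvalues_of_circleAverage_le {ψ : EuclideanSpace ℂ (Fin n) → ℝ}
    {p : EuclideanSpace ℂ (Fin n)} (hψ : ContDiffAt ℝ 2 ψ p)
    (V : Submodule ℂ (EuclideanSpace ℂ (Fin n))) {c : ℝ} (hc : 0 < c)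
    (h : ∀ b ∈ V, ∀ᶠ t in 𝓝[>] (0 : ℝ),
      Real.circleAverage (fun ζ : ℂ => ψ (p + ζ • t • b)) 0 1 ≤ ψ p - c * ‖b‖ ^ 2 * t ^ 2) :
    Module.finrank ℂ V ≤ numNegEigenvalues (complexHessian ψ p) := by
  rw [← numNegEigenvalues_transpose]
  refine le_numNegEigenvalues_of_submodule (complexHessian_isHermitian hψ).transpose V
    fun b hb hb0 => ?_
  rw [re_dotProduct_transpose_complexHessian hψ]
  refine (levi_le_of_circleAverage_le hψ (h b hb)).trans_lt ?_
  have := norm_pos_iff.2 hb0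
  have : 0 < c * ‖b‖ ^ 2 := by positivity
  linarith

theorem circleAverage_norm_sq (y b : EuclideanSpace ℂ (Fin n)) :
    Real.circleAverage (fun ζ : ℂ => ‖y + ζ • b‖ ^ 2) 0 1 = ‖y‖ ^ 2 + ‖b‖ ^ 2 := by
  let N : EuclideanSpace ℂ (Fin n) →L[ℝ] EuclideanSpace ℂ (Fin n) →L[ℝ] ℝ := innerSL ℝ
  have hN (v : EuclideanSpace ℂ (Fin n)) : N v v = ‖v‖ ^ 2 := real_inner_self_eq_norm_sq v
  have h1 (ζ : ℂ) : ‖y + ζ • b‖ ^ 2 = ‖y‖ ^ 2 + (N y + N.flip y) (ζ • b) + N (ζ • b) (ζ • b) := by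
    rw [← hN, ← hN]
    simp only [map_add, add_apply, ContinuousLinearMap.flip_apply]
    ring
  simp only [h1]
  rw [circleAverage_quadratic, hN, hN, norm_smul, Complex.norm_I, one_mul]
  ring

/-- A local maximum of `u - φ` in `U` can be turned into a maximum over `U` without changing the
test function near the maximum point. -/
theorem IsViscosityQPlurisubharmonicOn.numNegEigenvalues_le_of_isLocalMax {q : ℕ}
    {U : Set (EuclideanSpace ℂ (Fin n))} (hU : IsOpen U) {u : EuclideanSpace ℂ (Fin n) → EReal}
    (husc : UpperSemicontinuousOn u U) (hu : ∀ z ∈ U, u z ≠ ⊤)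
    (hv : IsViscosityQPlurisubharmonicOn q U u)
    {φ : EuclideanSpace ℂ (Fin n) → ℝ} (hφ : ContDiffOn ℝ 2 φ U)
    {p : EuclideanSpace ℂ (Fin n)} (hp : p ∈ U) (hup : u p ≠ ⊥)
    (hmax : ∀ᶠ z in 𝓝 p, u z - φ z ≤ u p - φ p) :
    ∃ ψ : EuclideanSpace ℂ (Fin n) → ℝ, ContDiffAt ℝ 2 ψ p ∧ ψ =ᶠ[𝓝 p] φ ∧
      numNegEigenvalues (complexHessian ψ p) ≤ q := by
  rcases hv with hbot | hv
  · exact absurd (hbot p hp) hup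
  lift u p to ℝ using ⟨hu p hp, hup⟩ with x hx
  -- The dominated function is `(u - φ) - (u p - φ p)`, nonpositive near `p`; thus `u - (φ + θ)` is
  -- maximal at `p` over all of `U`.
  obtain ⟨θ, hθ, hθp, hθu⟩ := exists_contDiffOn_ge hU (w := fun z => u z + ((-φ z - (x - φ p) : ℝ)))
    (husc.add_coe (hφ.continuousOn.neg.sub continuousOn_const))
    (fun z hz => by
      exact EReal.add_ne_top (hu z hz) (EReal.coe_ne_top _))
    (p := p) (by
      filter_upwards [hmax, hU.mem_nhds hp] with z hz hzU
      have := hu z hzU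
      induction hy : u z with
      | bot => simp
      | top => exact absurd hy this
      | coe y =>
        rw [hy] at hz
        norm_cast at hz ⊢
        linarith)
  rw [hU.nhdsWithin_eq hp] at hθp
  have hψ : ContDiffOn ℝ 2 (fun z => φ z + θ z) U := hφ.add hθ
  refine ⟨fun z => φ z + θ z, hψ.contDiffAt (hU.mem_nhds hp), ?_, hv _ hψ p hp fun z hz => ?_⟩
  · filter_upwards [hθp] with z hz
    simp [hz]
  · have h1 := hθu z hz
    have h0 : θ p = 0 := hθp.self_of_nhds
    have := hu z hz
    change u z - ((φ z + θ z : ℝ) : EReal) ≤ u p - ((φ p + θ p : ℝ) : EReal)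
    rw [h0, ← hx]
    induction hy : u z with
    | bot => simp
    | top => exact absurd hy this
    | coe y =>
      rw [hy] at h1
      norm_cast at h1 ⊢
      linarith

end Viscosity

/-! ### From viscosity to `q`-plurisubharmonic. -/

section Converse

open Topology Filter Metric

variable {n : ℕ}

/-- The `C²` test function attached to `g` on a complex subspace `V`, penalised by `k` in the
directions orthogonal to `V`. -/
noncomputable def penalizedTest (V : Submodule ℂ (EuclideanSpace ℂ (Fin n)))
    (p : EuclideanSpace ℂ (Fin n)) (g : V → ℝ) (a : V) (ε k : ℝ)
    (z : EuclideanSpace ℂ (Fin n)) : ℝ :=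
  k * ‖(z - p) - V.starProjection (z - p)‖ ^ 2
    - (g (V.orthogonalProjectionOnto (z - p)) + ε * ‖V.starProjection (z - p) - a‖ ^ 2)

theorem contDiff_penalizedTest (V : Submodule ℂ (EuclideanSpace ℂ (Fin n)))
    (p : EuclideanSpace ℂ (Fin n)) {g : V → ℝ} (hg : ContDiff ℝ 2 g) (a : V) (ε k : ℝ) :
    ContDiff ℝ 2 (penalizedTest V p g a ε k) := by
  have h1 : ContDiff ℝ 2 fun z : EuclideanSpace ℂ (Fin n) => z - p := by fun_prop
  have h2 : ContDiff ℝ 2 fun z : EuclideanSpace ℂ (Fin n) => V.starProjection (z - p) :=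
    (V.starProjection.restrictScalars ℝ).contDiff.comp h1
  have h3 : ContDiff ℝ 2
      fun z : EuclideanSpace ℂ (Fin n) => V.orthogonalProjectionOnto (z - p) :=
    (V.orthogonalProjectionOnto.restrictScalars ℝ).contDiff.comp h1
  unfold penalizedTest
  exact (contDiff_const.mul ((h1.sub h2).norm_sq ℝ)).sub
    ((hg.comp h3).add (contDiff_const.mul ((h2.sub contDiff_const).norm_sq ℝ)))

theorem penalizedTest_add (V : Submodule ℂ (EuclideanSpace ℂ (Fin n)))
    (p : EuclideanSpace ℂ (Fin n)) (g : V → ℝ) (a : V) (ε k : ℝ)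
    (z : EuclideanSpace ℂ (Fin n)) (b : V) :
    penalizedTest V p g a ε k (z + b) = k * ‖(z - p) - V.starProjection (z - p)‖ ^ 2
      - (g (V.orthogonalProjectionOnto (z - p) + b)
        + ε * ‖V.starProjection (z - p) - a + b‖ ^ 2) := by
  have h1 : (z + b : EuclideanSpace ℂ (Fin n)) - p = (z - p) + b := by abel
  have h2 : V.starProjection (b : EuclideanSpace ℂ (Fin n)) = b :=
    V.starProjection_eq_self_iff.2 b.2
  have h3 : V.orthogonalProjectionOnto (b : EuclideanSpace ℂ (Fin n)) = b := by
    ext1; exact h2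
  rw [penalizedTest, h1, map_add, map_add, h2, h3, add_sub_add_right_eq_sub, add_sub_right_comm]

/-- Along `V` the penalty is constant, `-g` does not increase on average, and `‖·‖²` gains exactly
`‖b‖²`. -/
theorem circleAverage_penalizedTest_le (V : Submodule ℂ (EuclideanSpace ℂ (Fin n)))
    (p : EuclideanSpace ℂ (Fin n)) {g : V → ℝ} (hg : Continuous g) (a : V) (ε k : ℝ)
    (z : EuclideanSpace ℂ (Fin n)) (b : V)
    (hsub : g (V.orthogonalProjectionOnto (z - p))
      ≤ Real.circleAverage (fun ζ : ℂ => g (V.orthogonalProjectionOnto (z - p) + ζ • b)) 0 1) :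
    Real.circleAverage (fun ζ : ℂ => penalizedTest V p g a ε k
        (z + ζ • (b : EuclideanSpace ℂ (Fin n)))) 0 1
      ≤ penalizedTest V p g a ε k z - ε * ‖b‖ ^ 2 := by
  have h1 (ζ : ℂ) := penalizedTest_add V p g a ε k z (ζ • b)
  simp only [Submodule.coe_smul] at h1
  have hint (f : ℂ → ℝ) (hf : Continuous f) : CircleIntegrable f 0 1 :=
    hf.continuousOn.circleIntegrable zero_le_one
  simp only [h1]
  rw [Real.circleAverage_fun_sub (hint _ (by fun_prop)) (hint _ (by fun_prop)),
    Real.circleAverage_fun_add (hint _ (by fun_prop)) (hint _ (by fun_prop)),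
    Real.circleAverage_const]
  have h2 := Real.circleAverage_fun_smul (a := ε) (c := 0) (R := 1)
    (f := fun ζ : ℂ => ‖V.starProjection (z - p) - a + ζ • (b : EuclideanSpace ℂ (Fin n))‖ ^ 2)
  simp only [smul_eq_mul] at h2
  rw [h2, circleAverage_norm_sq, penalizedTest, Submodule.coe_norm]
  linarith

/-- The closed tube of radius `η` about a subset of the affine subspace `p + V`, in the directions
orthogonal to `V`. -/
def tube (V : Submodule ℂ (EuclideanSpace ℂ (Fin n))) (p : EuclideanSpace ℂ (Fin n))
    (S : Set V) (η : ℝ) : Set (EuclideanSpace ℂ (Fin n)) :=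
  {z | V.orthogonalProjectionOnto (z - p) ∈ S ∧ ‖(z - p) - V.starProjection (z - p)‖ ≤ η}

theorem tube_subset_cthickening (V : Submodule ℂ (EuclideanSpace ℂ (Fin n)))
    (p : EuclideanSpace ℂ (Fin n)) (S : Set V) (η : ℝ) :
    tube V p S η ⊆ cthickening η ((fun v : V => (v : EuclideanSpace ℂ (Fin n)) + p) '' S) := by
  intro z hz
  refine mem_cthickening_of_dist_le z _ η _ (Set.mem_image_of_mem _ hz.1) ?_
  rw [dist_eq_norm, add_comm _ p, ← sub_sub]
  exact hz.2

theorem isCompact_tube (V : Submodule ℂ (EuclideanSpace ℂ (Fin n)))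
    (p : EuclideanSpace ℂ (Fin n)) {S : Set V} (hS : IsCompact S) (η : ℝ) :
    IsCompact (tube V p S η) := by
  refine IsCompact.of_isClosed_subset (hS.image (by fun_prop)).cthickening ?_
    (tube_subset_cthickening V p S η)
  have h1 : Continuous fun z : EuclideanSpace ℂ (Fin n) => V.orthogonalProjectionOnto (z - p) := by
    fun_prop
  have h2 :
      Continuous fun z : EuclideanSpace ℂ (Fin n) => ‖(z - p) - V.starProjection (z - p)‖ := by
    fun_prop
  exact (hS.isClosed.preimage h1).inter (isClosed_le h2 continuous_const)

/-- If `G < D` on the sphere but `D < G` somewhere in the ball, then subtracting a large multiple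
of the squared distance to the affine subspace creates a local maximum over the ambient space. -/
theorem exists_penalized_isLocalMax {U : Set (EuclideanSpace ℂ (Fin n))} (hU : IsOpen U)
    (V : Submodule ℂ (EuclideanSpace ℂ (Fin n))) (p : EuclideanSpace ℂ (Fin n))
    {a : V} {r : ℝ} (hball : ∀ v ∈ closedBall a r, (v : EuclideanSpace ℂ (Fin n)) + p ∈ U)
    {G : EuclideanSpace ℂ (Fin n) → EReal} (hG : UpperSemicontinuousOn G U)
    (hGt : ∀ z ∈ U, G z ≠ ⊤) {D : ℝ}
    (hsph : ∀ v ∈ sphere a r, G ((v : EuclideanSpace ℂ (Fin n)) + p) < D)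
    {v₀ : V} (hv₀ : v₀ ∈ closedBall a r) (hGv₀ : D < G ((v₀ : EuclideanSpace ℂ (Fin n)) + p)) :
    ∃ k : ℝ, ∃ z ∈ U, G z ≠ ⊥ ∧ V.orthogonalProjectionOnto (z - p) ∈ ball a r ∧
      ∀ᶠ y in 𝓝 z, G y + ((-(k * ‖(y - p) - V.starProjection (y - p)‖ ^ 2) : ℝ) : EReal)
        ≤ G z + ((-(k * ‖(z - p) - V.starProjection (z - p)‖ ^ 2) : ℝ) : EReal) := by
  -- By semicontinuity `G < D` persists near the sphere, hence on the whole tube over it once `η` is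
  -- small.
  let O : Set (EuclideanSpace ℂ (Fin n)) := {z | z ∈ U ∧ G z < D}
  have hO : IsOpen O := by
    rw [isOpen_iff_mem_nhds]
    intro z hz
    have := hG z hz.1 D hz.2
    rw [hU.nhdsWithin_eq hz.1] at this
    exact Filter.inter_mem (hU.mem_nhds hz.1) this
  let i : V → EuclideanSpace ℂ (Fin n) := fun v => (v : EuclideanSpace ℂ (Fin n)) + p
  have hi : Continuous i := by fun_prop
  have : ProperSpace V := FiniteDimensional.proper ℂ V
  obtain ⟨η₁, hη₁, hηU⟩ := ((isCompact_closedBall a r).image hi).exists_cthickening_subset_open hU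
    (Set.image_subset_iff.2 hball)
  obtain ⟨η₂, hη₂, hηO⟩ := ((isCompact_sphere a r).image hi).exists_cthickening_subset_open hO
    (Set.image_subset_iff.2 fun v hv => ⟨hball v (sphere_subset_closedBall hv), hsph v hv⟩)
  set η := min η₁ η₂
  have hη : 0 < η := lt_min hη₁ hη₂
  set K := tube V p (closedBall a r) η with hK_def
  have hK : IsCompact K := isCompact_tube V p (isCompact_closedBall a r) η
  have hKU : K ⊆ U := (tube_subset_cthickening V p _ η).trans
    ((cthickening_mono (min_le_left _ _) _).trans hηU)
  have hLO : tube V p (sphere a r) η ⊆ O := (tube_subset_cthickening V p _ η).trans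
    ((cthickening_mono (min_le_right _ _) _).trans hηO)
  have hproj : i v₀ - p = v₀ := add_sub_cancel_right _ _
  have hQ0 : (i v₀ - p) - V.starProjection (i v₀ - p) = 0 := by
    rw [hproj, V.starProjection_eq_self_iff.2 v₀.2, sub_self]
  have hv₀K : i v₀ ∈ K := by
    refine ⟨?_, by rw [hQ0, norm_zero]; exact hη.le⟩
    rwa [hproj, show V.orthogonalProjectionOnto (v₀ : EuclideanSpace ℂ (Fin n)) = v₀ from
      Subtype.ext (V.starProjection_eq_self_iff.2 v₀.2)]
  obtain ⟨y, hyK, hy⟩ := (hG.mono hKU).exists_isMaxOn ⟨_, hv₀K⟩ hK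
  obtain ⟨m, hm, -⟩ := EReal.lt_iff_exists_real_btwn.1 (lt_top_iff_ne_top.2 (hGt y (hKU hyK)))
  -- As `G ≤ m` on the tube, this `k` brings the penalised function down to at most `D` at distance
  -- `η`.
  set k := |m - D| / η ^ 2 with hk_def
  have hk : 0 ≤ k := by positivity
  have hkη : m - k * η ^ 2 ≤ D := by
    have : k * η ^ 2 = |m - D| := by rw [hk_def]; field_simp
    linarith [le_abs_self (m - D)]
  let P : EuclideanSpace ℂ (Fin n) → ℝ :=
    fun z => -(k * ‖(z - p) - V.starProjection (z - p)‖ ^ 2)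
  have hP : Continuous P := by fun_prop
  obtain ⟨z, hzK, hz⟩ := ((hG.mono hKU).add_coe hP.continuousOn).exists_isMaxOn ⟨_, hv₀K⟩ hK
  -- The penalty vanishes at `v₀`, so the maximum exceeds `D`; this keeps `z` off both parts of the
  -- tube's boundary.
  have hzD : (D : EReal) < G z + P z := by
    refine hGv₀.trans_le (le_trans (le_of_eq ?_) (hz hv₀K))
    change G (i v₀) = G (i v₀) + P (i v₀)
    have : P (i v₀) = 0 := by simp only [P, hQ0, norm_zero]; ring
    simp [this]
  have hPz : P z ≤ 0 := neg_nonpos.2 (by positivity)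
  have hGz : (D : EReal) < G z := by
    refine hzD.trans_le ?_
    calc G z + P z ≤ G z + ((0 : ℝ) : EReal) := by
          gcongr
      _ = G z := by simp
  have hz1 : V.orthogonalProjectionOnto (z - p) ∈ ball a r := by
    refine lt_of_le_of_ne (mem_closedBall.1 hzK.1) fun h => ?_
    exact absurd (hLO ⟨h, hzK.2⟩).2 hGz.not_gt
  have hz2 : ‖(z - p) - V.starProjection (z - p)‖ < η := by
    refine lt_of_le_of_ne hzK.2 fun h => absurd hzD (not_lt.2 ?_)
    calc G z + P z ≤ (m : EReal) + P z := by
          gcongr; exact (hy hzK).trans hm.le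
      _ = ((m - k * η ^ 2 : ℝ) : EReal) := by simp only [P, h]; norm_cast
      _ ≤ D := by exact_mod_cast hkη
  refine ⟨k, z, hKU hzK, ((EReal.bot_lt_coe D).trans hGz).ne', hz1, ?_⟩
  have hproj_cont :
      Continuous fun z : EuclideanSpace ℂ (Fin n) => V.orthogonalProjectionOnto (z - p) := by
    fun_prop
  have hdist_cont :
      Continuous fun z : EuclideanSpace ℂ (Fin n) => ‖(z - p) - V.starProjection (z - p)‖ := by
    fun_prop
  have hopen : IsOpen {z | V.orthogonalProjectionOnto (z - p) ∈ ball a r ∧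
      ‖(z - p) - V.starProjection (z - p)‖ < η} :=
    (isOpen_ball.preimage hproj_cont).inter (isOpen_lt hdist_cont continuous_const)
  filter_upwards [hopen.mem_nhds ⟨hz1, hz2⟩] with y hy
  exact hz (⟨ball_subset_closedBall hy.1, hy.2.le⟩ : y ∈ K)

theorem IsViscosityQPlurisubharmonicOn.isQPlurisubharmonicOn {q : ℕ}
    {U : Set (EuclideanSpace ℂ (Fin n))} (hU : IsOpen U) {u : EuclideanSpace ℂ (Fin n) → EReal}
    (husc : UpperSemicontinuousOn u U) (hu : ∀ z ∈ U, u z ≠ ⊤)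
    (hv : IsViscosityQPlurisubharmonicOn q U u) : IsQPlurisubharmonicOn q U u := by
  intro _ π hπ p _
  set V := π.direction
  -- The maximum condition is proved in every case, including `u ≡ -∞` on the slice.
  refine Or.inr fun a r hr hball W h hW hBW hpsh => ?_
  by_contra! hno
  have : ProperSpace V := FiniteDimensional.proper ℂ V
  have : FiniteDimensional ℝ V := FiniteDimensional.trans ℝ ℂ V
  -- Dimension `q + 1 > 0` makes the sphere nonempty.
  have : Nontrivial V := Module.nontrivial_of_finrank_pos (R := ℂ) (by omega)
  let i : V → EuclideanSpace ℂ (Fin n) := fun v => (v : EuclideanSpace ℂ (Fin n)) + p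
  have hi : Continuous i := by fun_prop
  let f : V → EReal := fun v => u (i v) + h v
  have hf : UpperSemicontinuousOn f (closedBall a r) :=
    UpperSemicontinuousOn.add_coe (husc.comp hi.continuousOn hball) (hpsh.continuousOn.mono hBW)
  obtain ⟨v₀, hv₀, hmax⟩ := hf.exists_isMaxOn ⟨a, mem_closedBall_self hr.le⟩
    (isCompact_closedBall a r)
  obtain ⟨s₀, hs₀, hsmax⟩ := (hf.mono sphere_subset_closedBall).exists_isMaxOn
    (NormedSpace.sphere_nonempty.2 hr.le) (isCompact_sphere a r)
  have hlt : f s₀ < f v₀ := by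
    by_contra! hle
    exact hno s₀ hs₀ fun v hv => (hmax hv).trans hle
  obtain ⟨m₁, hm₁, hm₁v⟩ := EReal.lt_iff_exists_real_btwn.1 hlt
  obtain ⟨m₂, hm₁₂, hm₂v⟩ := EReal.lt_iff_exists_real_btwn.1 hm₁v
  have hm₁₂ : m₁ < m₂ := by exact_mod_cast hm₁₂
  set δ := m₂ - m₁ with hδ_def
  have hδ : 0 < δ := sub_pos.2 hm₁₂
  obtain ⟨g, hg, hgh, η, hη, hgsub⟩ :=
    hpsh.exists_contDiff_approx hW hBW (show 0 < δ / 4 by positivity)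
  -- Smoothing and the quadratic term cost at most `δ / 4` each: `u + H` stays below `m₁ + δ / 2` on
  -- the sphere and above `m₁ + 3δ / 4` at `v₀`.
  set ε := δ / (4 * r ^ 2) with hε_def
  have hε : 0 < ε := by positivity
  have hεr : ε * r ^ 2 = δ / 4 := by rw [hε_def]; field_simp
  let H : EuclideanSpace ℂ (Fin n) → ℝ := fun z =>
    g (V.orthogonalProjectionOnto (z - p)) + ε * ‖V.starProjection (z - p) - a‖ ^ 2
  have hH : Continuous H := by
    have := hg.continuous
    fun_prop
  have hHi (v : V) : H (i v) = g v + ε * ‖v - a‖ ^ 2 := by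
    have h1 : V.starProjection (v : EuclideanSpace ℂ (Fin n)) = v :=
      V.starProjection_eq_self_iff.2 v.2
    have h2 : V.orthogonalProjectionOnto (v : EuclideanSpace ℂ (Fin n)) = v := Subtype.ext h1
    simp only [H, i, add_sub_cancel_right, h1, h2, Submodule.coe_norm, Submodule.coe_sub]
  obtain ⟨k, z, hzU, hzb, hzP, hzmax⟩ := exists_penalized_isLocalMax hU V p hball
    (G := fun z => u z + (H z : EReal)) (husc.add_coe hH.continuousOn)
    (fun z hz => EReal.add_ne_top (hu z hz) (EReal.coe_ne_top _)) (D := m₁ + δ / 2)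
    (fun v hv => by
      have h1 : f v < m₁ := (hsmax hv).trans_lt hm₁
      have h2 := (abs_le.1 (hgh v (sphere_subset_closedBall hv))).2
      change u (i v) + (H (i v) : EReal) < _
      have h3 : ‖v - a‖ = r := by rw [← dist_eq_norm]; exact hv
      rw [hHi, h3, hεr]
      change u (i v) + (h v : EReal) < m₁ at h1
      have hvt := hu (i v) (hball (sphere_subset_closedBall hv))
      induction hy : u (i v) with
      | bot => simp [-EReal.coe_add, EReal.bot_lt_coe]
      | top => exact absurd hy hvt
      | coe y =>
        rw [hy] at h1
        norm_cast at h1 ⊢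
        linarith)
    (v₀ := v₀) hv₀ (by
      have h2 := (abs_le.1 (hgh v₀ hv₀)).1
      change _ < u (i v₀) + (H (i v₀) : EReal)
      have h3 : 0 ≤ ε * ‖v₀ - a‖ ^ 2 := by positivity
      rw [hHi]
      change (m₂ : EReal) < u (i v₀) + (h v₀ : EReal) at hm₂v
      have hvt := hu (i v₀) (hball hv₀)
      induction hy : u (i v₀) with
      | bot => simp [hy] at hm₂v
      | top => exact absurd hy hvt
      | coe y =>
        rw [hy] at hm₂v
        norm_cast at hm₂v ⊢
        linarith)
  set φ := penalizedTest V p g a ε k with hφ_def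
  have hφ : ContDiff ℝ 2 φ := contDiff_penalizedTest V p hg a ε k
  have huz : u z ≠ ⊥ := fun h => hzb (by simp [h])
  have hφH (y : EuclideanSpace ℂ (Fin n)) :
      u y - φ y = u y + H y + ((-(k * ‖(y - p) - V.starProjection (y - p)‖ ^ 2) : ℝ) : EReal) := by
    rw [add_assoc, ← EReal.coe_add, sub_eq_add_neg, ← EReal.coe_neg]
    congr 2
    simp only [hφ_def, penalizedTest, H]
    ring
  obtain ⟨ψ, hψ, hψφ, hle⟩ := hv.numNegEigenvalues_le_of_isLocalMax hU husc hu hφ.contDiffOn hzU huz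
    (by simpa only [hφH] using hzmax)
  refine absurd hle (not_le.2 ?_)
  rw [← Nat.succ_le_iff, Nat.succ_eq_add_one, ← hπ]
  refine finrank_le_numNegEigenvalues_of_circleAverage_le hψ V hε fun b hb => ?_
  obtain ⟨s, hs, hsψ⟩ := Metric.eventually_nhds_iff_ball.1 hψφ
  -- Small `t` keeps the circle where `ψ = φ` and within the range `η` of the sub-mean value
  -- inequality for `g`.
  filter_upwards [eventually_norm_smul_smul_lt b (lt_min hs hη), self_mem_nhdsWithin]
    with t ht ht0
  have ht0 : 0 < t := ht0
  have h1 : Real.circleAverage (fun ζ : ℂ => ψ (z + ζ • t • b)) 0 1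
      = Real.circleAverage (fun ζ : ℂ => φ (z + ζ • t • b)) 0 1 := by
    refine Real.circleAverage_congr_sphere fun ζ hζ => hsψ _ ?_
    rw [mem_ball, dist_eq_norm, add_sub_cancel_left]
    exact (ht ζ (by simpa using hζ)).trans_le (min_le_left _ _)
  have hb1 : ‖t • b‖ ≤ η := by
    have := (ht 1 (by simp)).le.trans (min_le_right _ _)
    rwa [one_smul] at this
  have h2 := circleAverage_penalizedTest_le V p hg.continuous a ε k z (t • (⟨b, hb⟩ : V))
    (hgsub _ (ball_subset_closedBall hzP) _ hb1)
  have h3 : ‖t • (⟨b, hb⟩ : V)‖ = t * ‖b‖ := by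
    rw [norm_smul, Real.norm_of_nonneg ht0.le]; rfl
  rw [h3] at h2
  rw [h1, hψφ.self_of_nhds]
  refine h2.trans (le_of_eq ?_)
  ring

end Converse

theorem mainTheorem1 (n q : ℕ) (U : Set (EuclideanSpace ℂ (Fin n))) (hU : IsOpen U)
    (hUne : U.Nonempty) (u : EuclideanSpace ℂ (Fin n) → EReal)
    (husc : UpperSemicontinuousOn u U) (hu : ∀ z ∈ U, u z ≠ ⊤) :
    IsQPlurisubharmonicOn q U u ↔ IsViscosityQPlurisubharmonicOn q U u :=
  ⟨fun h => h.isViscosityQPlurisubharmonicOn hU hu,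
    fun h => h.isQPlurisubharmonicOn hU husc hu⟩
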